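/- **Setting.** Let $\Lambda$ be an algebra of commuting and anticommuting c-numbers: a real Banach algebra with a splitting $\Lambda=\Lambda_0\oplus\Lambda_1$ into an even and an odd part, $1\in\Lambda_0$, $\Lambda_i\Lambda_j\subseteq\Lambda_{i+j}$ and $ab=(-1)^{ij}ba$ for $a\in\Lambda_i$, $b\in\Lambda_j$. (For ordinary real fields $\Lambda=\Lambda_0=\mathbb R$; for anticommuting fields $\Lambda$ is a Grassmann algebra.) Consider a field on space-time $\mathbb R\times\mathbb R^n$ with finitely many components $\phi^a$ and canonical momenta $\pi_a$, where $\phi^a,\pi_a$ take values in $\Lambda_{\epsilon_a}$, $\epsilon_a\in\{0,1\}$. A phase space point is a smooth map $p=(\phi,\pi)$ on $\mathbb R^n$. *Brackets.* A continuous $D=(\frac{\delta F}{\delta\phi^a},\frac{\delta F}{\delta\pi_a})$ is a (left) functional derivative of a $\Lambda$-valued functional $F$ at $p$ if $\delta F=\int\sum_a(\delta\phi^a\frac{\delta F}{\delta\phi^a}+\delta\pi_a\frac{\delta F}{\delta\pi_a})\,dV$ for all smooth compactly supported variations. A continuous $X=(X^\phi,X^\pi)$ with the parities of the fields is a Hamiltonian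 vector field of an (even) functional $G$ at $p$ if $\delta G=\int\sum_a(X^\phi_a\,\delta\pi_a-\delta\phi^a\,X^\pi_a)\,dV$ for all such variations. The generalised Poisson bracket is $\{F,G\}=\int\sum_a(X^\phi_a\frac{\delta F}{\delta\phi^a}+X^\pi_a\frac{\delta F}{\delta\pi_a})\,dV$; for commuting fields this is $\int\sum_a(\frac{\delta F}{\delta\phi^a}\frac{\delta G}{\delta\pi_a}-\frac{\delta F}{\delta\pi_a}\frac{\delta G}{\delta\phi^a})\,dV$. The smeared fields are $\phi^a(f)=\int\phi^af\,dV$ and $\pi_a(f)=\int f\pi_a\,dV$ with $f$ smooth, compactly supported, with values in $\Lambda_{\epsilon_a}$; they satisfy the canonical relations $\{\phi^a(f),\pi_b(g)\}=\delta^a_b\int gf\,dV$, i.e. $\{\phi^a(\vec x),\pi_b(\vec y)\}=\pm\delta^a_b\,\delta(\vec x-\vec y)$. *Theory.* Let a field theory be given by a Hamiltonian $H=\int\mathcal H\,dV$ whose even density $\mathcal H$ is a smooth function of $t$, $\vec x$, $\phi,\pi$ and finitely many of their spatial derivatives, and whose Hamilton equations $\partial_t(\phi,\pi)=X_H$ have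 a right-hand side of the same local and smooth kind. ($\mathcal H$ is replaced by $\mathcal H-\mathcal H|_p$ in variations at $p$, so that $H$ need not converge. No invariance of the theory is needed; Poincaré-invariant theories are included.) *Topological current.* Let $J_T^\mu$, $\mu=0,\dots,n$, be $C^1$ functions of the coordinates, of $\phi,\pi$, and of their space-time derivatives up to some order $k$, with values in $\Lambda$, such that $d_\mu J_T^\mu=0$ holds identically, i.e. for all smooth $(\phi,\pi)$ on space-time, whether or not they solve any equation of motion. Its charge is the phase space functional $Q_T(t,p)=\int J_T^0\,dV$, where the time derivatives occurring in $J_T^0$ are expressed through $p$ by Hamilton's equations. **Theorem.** Let $t\in\mathbb R$ and let $p=(\phi,\pi)$ be a phase space point at which $J_T^0$ is integrable over $\mathbb R^n$. Then, at $p$: 1. all functional derivatives of $Q_T(t,\cdot)$ vanish (zero is a functional derivative of $Q_T$), and $Q_T$ generates no transformation: the brackets $\{Q_T,\phi^a(f)\}$ and $\{Q_T,\pi_a(f)\}$ exist and are $0$ for all $a$ and $f$, i.e. $\{Q_T,\phi(\vec x)\}=0$ and $\{Q_T,\pi(\vec x)\}=0$; 2. $\{Q_T,G\}=0$ for every functional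 $G$ that has a Hamiltonian vector field at $p$, in particular $\{Q_T,H\}=0$; 3. if $Q_T$ is conserved in the sense that $\partial Q_T/\partial t$ exists and $\partial Q_T/\partial t+\{Q_T,H\}=0$, then $\partial Q_T/\partial t=0$. Moreover, if $u$ is a smooth history that solves Hamilton's equations for times near $t$, if $u(s,\cdot)-u(t,\cdot)$ has compact support for all $s$ near $t$, and if $\frac{d}{ds}Q_T(s,u(s,\cdot))\big|_{s=t}=0$, then $\frac{\partial}{\partial s}Q_T(s,u(t,\cdot))\big|_{s=t}=0$. So a conserved topological charge has no explicit time dependence. -/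

import Mathlib

open MeasureTheory Filter Topology
open scoped ContDiff

noncomputable section

namespace FieldTheory

/-- Physical space `ℝⁿ`. -/
abbrev Space (n : ℕ) : Type := EuclideanSpace ℝ (Fin n)

/-- Space-time `ℝ × ℝⁿ`; the first factor is time. -/
abbrev Spacetime (n : ℕ) : Type := ℝ × Space n

/-- The coordinate vectors of space-time: `μ = 0` is time, the others are the spatial directions. -/
def coordVec (n : ℕ) : Fin (n + 1) → Spacetime n :=
  Fin.cons (1, 0) (fun i => (0, EuclideanSpace.single i 1))

/-- The grading of an algebra `Λ` of commuting and anticommuting c-numbers: `Λ` is the direct sum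
of its even part `part 0` and its odd part `part 1`, and homogeneous elements commute up to the
usual sign.  Ordinary real numbers are the case `part 0 = ⊤`, `part 1 = ⊥` in `ℝ`;
Grassmann algebras are the case used for anticommuting fields. -/
structure SuperGrading (Λ : Type*) [NormedRing Λ] [NormedAlgebra ℝ Λ] where
  part : ZMod 2 → Submodule ℝ Λ
  one_mem : (1 : Λ) ∈ part 0
  mul_mem : ∀ {i j : ZMod 2} {a b : Λ}, a ∈ part i → b ∈ part j → a * b ∈ part (i + j)
  isCompl : IsCompl (part 0) (part 1)
  comm : ∀ {i j : ZMod 2} {a b : Λ}, a ∈ part i → b ∈ part j →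
    a * b = ((-1 : ℝ) ^ (i.val * j.val)) • (b * a)

section Phase

variable {n : ℕ} {Λ : Type*} [NormedRing Λ] [NormedAlgebra ℝ Λ]

/-- The values of the pair `(φ, π)` of a field with components `φ^a`, `a : ι`, and canonical momenta
`π_a`; `φ^a` and `π_a` are even or odd c-numbers according to the parity `par a`.
For `w : Value S par`, `(w a).1` is the value of `φ^a` and `(w a).2` that of `π_a`. -/
abbrev Value {ι : Type*} (S : SuperGrading Λ) (par : ι → ZMod 2) : Type _ :=
  (a : ι) → S.part (par a) × S.part (par a)

variable {ι : Type*} [Fintype ι] {S : SuperGrading Λ} {par : ι → ZMod 2}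

/-- Test variations: smooth and compactly supported. -/
def IsTest {E W : Type*} [NormedAddCommGroup E] [NormedSpace ℝ E] [NormedAddCommGroup W]
    [NormedSpace ℝ W] (f : E → W) : Prop :=
  ContDiff ℝ ∞ f ∧ HasCompactSupport f

/-- `D = (δF/δφ^a, δF/δπ_a)` is the (left) functional derivative at the phase space point `p` of the
functional `F`: `δF = ∫ ∑ₐ (δφ^a · δF/δφ^a + δπ_a · δF/δπ_a)` for all test variations. -/
def HasFunctionalDeriv (F : (Space n → Value S par) → Λ) (p : Space n → Value S par)
    (D : Space n → ι → Λ × Λ) : Prop :=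
  Continuous D ∧ ∀ η : Space n → Value S par, IsTest η →
    HasDerivAt (fun ε : ℝ => F (p + ε • η))
      (∫ x, ∑ a, (((η x a).1 : Λ) * (D x a).1 + ((η x a).2 : Λ) * (D x a).2)) 0

/-- `X = (X^φ, X^π)` is the Hamiltonian vector field at `p` of the even functional `G`:
`δG = ∫ ∑ₐ (X^φ_a · δπ_a - δφ^a · X^π_a)` for all test variations.  For commuting fields this says
`X^φ = δG/δπ`, `X^π = -δG/δφ`; for anticommuting ones it says `X^φ = -δG/δπ`, `X^π = -δG/δφ`
with left derivatives. -/
def IsHamiltonianField (G : (Space n → Value S par) → Λ) (p : Space n → Value S par)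
    (X : Space n → Value S par) : Prop :=
  Continuous X ∧ ∀ η : Space n → Value S par, IsTest η →
    HasDerivAt (fun ε : ℝ => G (p + ε • η))
      (∫ x, ∑ a, (((X x a).1 : Λ) * ((η x a).2 : Λ) - ((η x a).1 : Λ) * ((X x a).2 : Λ))) 0

/-- The generalised Poisson bracket `{F, G}` of a functional `F` with an even functional `G` exists
at the phase space point `p` and equals `c`.  For commuting fields it is the usual
`∫ ∑ₐ (δF/δφ^a · δG/δπ_a - δF/δπ_a · δG/δφ^a)`, and for anticommuting ones
`(-1)^|F| ∫ ∑ₐ (δF/δφ^a · δG/δπ_a + δF/δπ_a · δG/δφ^a)` with left derivatives. -/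
def HasBracket (F G : (Space n → Value S par) → Λ) (p : Space n → Value S par) (c : Λ) : Prop :=
  ∃ (D : Space n → ι → Λ × Λ) (X : Space n → Value S par),
    HasFunctionalDeriv F p D ∧ IsHamiltonianField G p X ∧
    Integrable (fun x => ∑ a, (((X x a).1 : Λ) * (D x a).1 + ((X x a).2 : Λ) * (D x a).2)) ∧
    c = ∫ x, ∑ a, (((X x a).1 : Λ) * (D x a).1 + ((X x a).2 : Λ) * (D x a).2)

/-- The smeared field `∫ φ^a(x) f(x) dx`; the smearing function has the parity of the field, so
that the result is even. -/
def fieldObs (a : ι) (f : Space n → S.part (par a)) (p : Space n → Value S par) : Λ :=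
  ∫ x, ((p x a).1 : Λ) * (f x : Λ)

/-- The smeared canonical momentum `∫ f(x) π_a(x) dx`. -/
def momentumObs (a : ι) (f : Space n → S.part (par a)) (p : Space n → Value S par) : Λ :=
  ∫ x, (f x : Λ) * ((p x a).2 : Λ)

open Classical in
theorem field_hasFunctionalDeriv [CompleteSpace Λ] (a : ι)
    (f : Space n → S.part (par a)) (hf : IsTest f) (p : Space n → Value S par)
    (hp : ContDiff ℝ ∞ p) :
    HasFunctionalDeriv (fieldObs a f) p (fun x b => if b = a then ((f x : Λ), 0) else 0) := by
  have hfc : Continuous fun x => (f x : Λ) := continuous_subtype_val.comp hf.1.continuous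
  have hfs : HasCompactSupport fun x => (f x : Λ) :=
    hf.2.comp_left (g := (Subtype.val : S.part (par a) → Λ)) rfl
  have hI : ∀ q : Space n → Value S par, Continuous q →
      Integrable fun x => ((q x a).1 : Λ) * (f x : Λ) := fun q hq =>
    Continuous.integrable_of_hasCompactSupport
      ((continuous_subtype_val.comp (continuous_fst.comp ((continuous_apply a).comp hq))).mul hfc)
      hfs.mul_left
  constructor
  · refine continuous_pi fun b => ?_
    by_cases h : b = a
    · simpa [h] using hfc.prodMk continuous_const
    · simpa [h] using continuous_const
  · intro η hη
    have e : (fun ε : ℝ => fieldObs a f (p + ε • η)) = fun ε : ℝ =>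
        fieldObs a f p + ε • ∫ x, ((η x a).1 : Λ) * (f x : Λ) := by
      ext ε
      simp only [fieldObs]
      rw [← integral_smul]
      refine Eq.trans ?_ (integral_add (hI p hp.continuous) ((hI η hη.1.continuous).smul ε))
      congr 1; ext x; simp [add_mul]
    rw [e]
    have : (∫ x, ∑ b, (((η x b).1 : Λ) * (if b = a then ((f x : Λ), (0 : Λ)) else 0).1 +
        ((η x b).2 : Λ) * (if b = a then ((f x : Λ), (0 : Λ)) else 0).2)) =
        ∫ x, ((η x a).1 : Λ) * (f x : Λ) := by
      congr 1; ext x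
      rw [Finset.sum_eq_single a]
      · simp
      · intro b _ h; simp [h]
      · simp
    rw [this]
    simpa using ((hasDerivAt_id (0:ℝ)).smul_const (∫ x, ((η x a).1 : Λ) * (f x : Λ))).const_add (fieldObs a f p)

open Classical in
theorem momentum_ham [CompleteSpace Λ] (a : ι)
    (f : Space n → S.part (par a)) (hf : IsTest f) (p : Space n → Value S par)
    (hp : ContDiff ℝ ∞ p) :
    IsHamiltonianField (momentumObs a f) p (fun x => Function.update 0 a (f x, 0)) := by
  have hfc : Continuous fun x => (f x : Λ) := continuous_subtype_val.comp hf.1.continuous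
  have hfs : HasCompactSupport fun x => (f x : Λ) :=
    hf.2.comp_left (g := (Subtype.val : S.part (par a) → Λ)) rfl
  have hI : ∀ q : Space n → Value S par, Continuous q →
      Integrable fun x => (f x : Λ) * ((q x a).2 : Λ) := fun q hq =>
    Continuous.integrable_of_hasCompactSupport
      (hfc.mul (continuous_subtype_val.comp (continuous_snd.comp ((continuous_apply a).comp hq))))
      hfs.mul_right
  constructor
  · exact continuous_const.update a (hf.1.continuous.prodMk continuous_const)
  · intro η hη
    have e : (fun ε : ℝ => momentumObs a f (p + ε • η)) = fun ε : ℝ =>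
        momentumObs a f p + ε • ∫ x, (f x : Λ) * ((η x a).2 : Λ) := by
      ext ε
      simp only [momentumObs]
      rw [← integral_smul]
      refine Eq.trans ?_ (integral_add (hI p hp.continuous) ((hI η hη.1.continuous).smul ε))
      congr 1; ext x; simp [mul_add]
    rw [e]
    have : (∫ x, ∑ b, ((((Function.update 0 a (f x, 0) : Value S par) b).1 : Λ) * ((η x b).2 : Λ) -
        ((η x b).1 : Λ) * (((Function.update 0 a (f x, 0) : Value S par) b).2 : Λ))) =
        ∫ x, (f x : Λ) * ((η x a).2 : Λ) := by
      congr 1; ext x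
      rw [Finset.sum_eq_single a]
      · simp
      · intro b _ h; simp [h]
      · simp
    rw [this]
    simpa using ((hasDerivAt_id (0:ℝ)).smul_const (∫ x, (f x : Λ) * ((η x a).2 : Λ))).const_add (momentumObs a f p)

open Classical in
/-- The canonical Poisson brackets `{φ^a(f), π_b(g)} = δ^a_b ∫ g f`. -/
theorem canonical_bracket [CompleteSpace Λ] (a b : ι)
    (f : Space n → S.part (par a)) (hf : IsTest f) (g : Space n → S.part (par b)) (hg : IsTest g)
    (p : Space n → Value S par) (hp : ContDiff ℝ ∞ p) :
    HasBracket (fieldObs a f) (momentumObs b g) p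
      (if a = b then ∫ x, (g x : Λ) * (f x : Λ) else 0) := by
  have hfc : Continuous fun x => (f x : Λ) := continuous_subtype_val.comp hf.1.continuous
  have hgc : Continuous fun x => (g x : Λ) := continuous_subtype_val.comp hg.1.continuous
  have hfs : HasCompactSupport fun x => (f x : Λ) :=
    hf.2.comp_left (g := (Subtype.val : S.part (par a) → Λ)) rfl
  refine ⟨_, _, field_hasFunctionalDeriv a f hf p hp, momentum_ham b g hg p hp, ?_⟩
  have key : (fun x => ∑ d, ((((Function.update 0 b (g x, 0) : Value S par) d).1 : Λ) *
      (if d = a then ((f x : Λ), (0 : Λ)) else 0).1 +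
      (((Function.update 0 b (g x, 0) : Value S par) d).2 : Λ) *
      (if d = a then ((f x : Λ), (0 : Λ)) else 0).2)) =
      fun x => if a = b then (g x : Λ) * (f x : Λ) else 0 := by
    ext x
    rw [Finset.sum_eq_single b]
    · by_cases h : a = b
      · simp [h]
      · simp [h, Ne.symm h]
    · intro d _ h; simp [h]
    · simp
  rw [key]
  by_cases h : a = b
  · simp only [h, if_true, and_true]
    exact (hgc.mul hfc).integrable_of_hasCompactSupport hfs.mul_left
  · simp [h]

end Phase

section Jets

variable {E W : Type*} [NormedAddCommGroup E] [NormedSpace ℝ E] [NormedAddCommGroup W]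
  [NormedSpace ℝ W]

/-- The values of all derivatives of order at most `k` of a function `E → W` at a point. -/
abbrev Jet (k : ℕ) (E W : Type*) [NormedAddCommGroup E] [NormedSpace ℝ E] [NormedAddCommGroup W]
    [NormedSpace ℝ W] : Type _ :=
  (i : Fin (k + 1)) → ContinuousMultilinearMap ℝ (fun _ : Fin (i : ℕ) => E) W

/-- The `k`-jet of `u` at `x`. -/
def jet (k : ℕ) (u : E → W) (x : E) : Jet k E W := fun i => iteratedFDeriv ℝ (i : ℕ) u x

end Jets

/-- A classical field theory in Hamiltonian form: a local Hamiltonian `H = ∫ density`, where the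
density is a smooth function of time, position, the fields `φ, π` and finitely many of their spatial
derivatives, together with the right-hand side `velocity` of Hamilton's equations
`∂_t (φ, π) = velocity`, which is local and smooth as well.
As `H` itself may be infinite, Hamilton's equations refer to the energy relative to `p`. -/
structure HamiltonianTheory (n : ℕ) {Λ : Type*} [NormedRing Λ] [NormedAlgebra ℝ Λ]
    {ι : Type*} [Fintype ι] (S : SuperGrading Λ) (par : ι → ZMod 2) where
  order : ℕ
  density : Spacetime n → Jet order (Space n) (Value S par) → Λ
  density_smooth : ContDiff ℝ ∞ (fun z : Spacetime n × Jet order (Space n) (Value S par) =>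
    density z.1 z.2)
  density_even : ∀ y j, density y j ∈ S.part 0
  velocityOrder : ℕ
  velocity : Spacetime n → Jet velocityOrder (Space n) (Value S par) → Value S par
  velocity_smooth : ContDiff ℝ ∞
    (fun z : Spacetime n × Jet velocityOrder (Space n) (Value S par) => velocity z.1 z.2)
  hamilton : ∀ (t : ℝ) (p : Space n → Value S par), ContDiff ℝ ∞ p →
    IsHamiltonianField
      (fun q => ∫ x, (density (t, x) (jet order q x) - density (t, x) (jet order p x)))
      p (fun x => velocity (t, x) (jet velocityOrder p x))

section Charge

variable {n : ℕ} {Λ : Type*} [NormedRing Λ] [NormedAlgebra ℝ Λ]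
  {ι : Type*} [Fintype ι] {S : SuperGrading Λ} {par : ι → ZMod 2}

namespace HamiltonianTheory

/-- The Hamiltonian at time `t`, measured relative to the phase space point `p`. -/
def hamiltonian (T : HamiltonianTheory n S par) (t : ℝ) (p q : Space n → Value S par) : Λ :=
  ∫ x, (T.density (t, x) (jet T.order q x) - T.density (t, x) (jet T.order p x))

/-- The Hamiltonian vector field on phase space at time `t`. -/
def evolution (T : HamiltonianTheory n S par) (t : ℝ) (p : Space n → Value S par) :
    Space n → Value S par :=
  fun x => T.velocity (t, x) (jet T.velocityOrder p x)

/-- `u` obeys Hamilton's equations at all times near `t`. -/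
def IsMotionNear (T : HamiltonianTheory n S par) (t : ℝ) (u : Spacetime n → Value S par) : Prop :=
  ∀ᶠ s in 𝓝 t, ∀ x, HasDerivAt (fun r => u (r, x)) (T.evolution s (fun y => u (s, y)) x) s

/-- The `j`-th time derivative of `(φ, π)`, expressed at time `t` through the phase space
point `p` alone by repeated use of Hamilton's equations. -/
def timeDeriv (T : HamiltonianTheory n S par) :
    ℕ → ℝ → (Space n → Value S par) → Space n → Value S par
  | 0 => fun _ p => p
  | j + 1 => fun t p x => deriv (fun s : ℝ => T.timeDeriv j (t + s) (p + s • T.evolution t p) x) 0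

/-- A history through `p` at time `t` whose time derivatives at `t` up to order `k` are the ones
that Hamilton's equations prescribe. -/
def history (T : HamiltonianTheory n S par) (k : ℕ) (t : ℝ) (p : Space n → Value S par) :
    Spacetime n → Value S par :=
  fun y => ∑ j ∈ Finset.range (k + 1),
    ((y.1 - t) ^ j / (j.factorial : ℝ)) • T.timeDeriv j t p y.2

end HamiltonianTheory

/-- A current: each component is a function of the coordinates, the fields `φ, π`, and
their space-time derivatives of order at most `k`. -/
abbrev Current (n k : ℕ) {Λ : Type*} [NormedRing Λ] [NormedAlgebra ℝ Λ]
    {ι : Type*} [Fintype ι] (S : SuperGrading Λ) (par : ι → ZMod 2) : Type _ :=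
  Fin (n + 1) → Spacetime n → Jet k (Spacetime n) (Value S par) → Λ

variable {k : ℕ}

/-- A topological current: continuously differentiable in all its arguments, and its total
divergence vanishes for all smooth histories of the fields, whether or not they obey any equation
of motion. -/
def IsTopologicalCurrent (J : Current n k S par) : Prop :=
  (∀ μ, ContDiff ℝ 1 (fun z : Spacetime n × Jet k (Spacetime n) (Value S par) => J μ z.1 z.2)) ∧
  ∀ u : Spacetime n → Value S par, ContDiff ℝ ∞ u → ∀ y : Spacetime n,
    ∑ μ, fderiv ℝ (fun z => J μ z (jet k u z)) y (coordVec n μ) = 0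

/-- The charge density `J⁰` at time `t` as a function on phase space. -/
def chargeDensity (T : HamiltonianTheory n S par) (J : Current n k S par) (t : ℝ)
    (p : Space n → Value S par) (x : Space n) : Λ :=
  J 0 (t, x) (jet k (T.history k t p) (t, x))

/-- The charge `Q = ∫ J⁰ dV` at time `t` as a functional on phase space. -/
def charge (T : HamiltonianTheory n S par) (J : Current n k S par) (t : ℝ)
    (p : Space n → Value S par) : Λ :=
  ∫ x, chargeDensity T J t p x

end Charge

end FieldTheory

end

open FieldTheory

/-! At each time a topological charge depends only on the phase space point near spatial infinity.
Let `p` and `q` agree outside a compact set. Hamilton's equations are local in space, so the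
histories `u`, `v` that they prescribe through `p` and `q` agree outside a spatially compact region.
As the current is divergence-free off shell, it may be evaluated on a smooth `w` that equals `v` in
the past and `u` near the present, although `w` solves no equation of motion. The difference of the
charges of `w` and `v` does not depend on time, because the current flows nowhere at infinity, and
it vanishes in the past, so it vanishes now. Consequently `Q` is constant along every test
variation. -/

namespace FieldTheory

open Function Set

section Calculus

variable {P E W : Type*} [NormedAddCommGroup P] [NormedSpace ℝ P] [NormedAddCommGroup E]
  [NormedSpace ℝ E] [NormedAddCommGroup W] [NormedSpace ℝ W]

theorem contDiff_jet (k : ℕ) {u : E → W} (hu : ContDiff ℝ ∞ u) : ContDiff ℝ ∞ (jet k u) :=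
  contDiff_pi.2 fun _ => hu.iteratedFDeriv_right le_rfl

theorem eqOn_jet (k : ℕ) {u v : E → W} {U : Set E} (hU : IsOpen U) (h : EqOn u v U) :
    EqOn (jet k u) (jet k v) U := fun _ hx =>
  funext fun i =>
    ((h.eventuallyEq_of_mem (hU.mem_nhds hx)).iteratedFDeriv ℝ (i : ℕ)).eq_of_nhds

theorem iteratedFDeriv_comp_prodMk_right {f : P × E → W} (hf : ContDiff ℝ ∞ f) (i : ℕ) (r : P)
    (x : E) :
    iteratedFDeriv ℝ i (fun y => f (r, y)) x =
      (iteratedFDeriv ℝ i f (r, x)).compContinuousLinearMap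
        fun _ => ContinuousLinearMap.inr ℝ P E := by
  have hshift : ContDiff ℝ ∞ fun w : P × E => f (w + (r, 0)) :=
    hf.comp (contDiff_id.add contDiff_const)
  have hslice : (fun y => f (r, y)) =
      (fun w : P × E => f (w + (r, 0))) ∘ ContinuousLinearMap.inr ℝ P E := by
    ext y; simp
  rw [hslice, ContinuousLinearMap.iteratedFDeriv_comp_right _ hshift x (by exact_mod_cast le_top),
    iteratedFDeriv_comp_add_right]
  simp

theorem contDiff_uncurry_jet (k : ℕ) {f : P → E → W} (hf : ContDiff ℝ ∞ (uncurry f)) :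
    ContDiff ℝ ∞ (uncurry fun r => jet k (f r)) := by
  refine contDiff_pi.2 fun i => ?_
  have hslice : (fun z : P × E => jet k (f z.1) z.2 i) = fun z =>
      ContinuousMultilinearMap.compContinuousLinearMapL (𝕜 := ℝ) (F := W)
        (fun _ => ContinuousLinearMap.inr ℝ P E) (iteratedFDeriv ℝ (i : ℕ) (uncurry f) z) :=
    funext fun z => iteratedFDeriv_comp_prodMk_right hf i z.1 z.2
  exact hslice ▸ (ContinuousLinearMap.contDiff _).comp (hf.iteratedFDeriv_right le_rfl)

theorem contDiff_deriv_of_uncurry {f : E → ℝ → W} (hf : ContDiff ℝ ∞ (uncurry f)) (s : ℝ) :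
    ContDiff ℝ ∞ fun x => deriv (f x) s :=
  hf.fderiv_apply contDiff_const contDiff_const le_rfl

theorem exists_contDiff_eqOn_past_eqOn_future {u v : ℝ × E → W} (hu : ContDiff ℝ ∞ u)
    (hv : ContDiff ℝ ∞ v) {a b : ℝ} (hab : a < b) :
    ∃ w : ℝ × E → W, ContDiff ℝ ∞ w ∧ EqOn w v (Prod.fst ⁻¹' Iio a) ∧
      EqOn w u (Prod.fst ⁻¹' Ioi b) ∧ ∀ y, u y = v y → w y = v y := by
  have hab' : 0 < b - a := sub_pos.2 hab
  refine ⟨fun y => v y + Real.smoothTransition ((y.1 - a) / (b - a)) • (u y - v y),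
    hv.add ((Real.smoothTransition.contDiff.comp
      ((contDiff_fst.sub contDiff_const).div_const _)).smul (hu.sub hv)),
    fun y hy => ?_, fun y hy => ?_, fun y hy => by simp [hy]⟩
  · have hpast : (y.1 - a) / (b - a) ≤ 0 :=
      div_nonpos_of_nonpos_of_nonneg (sub_nonpos.2 (le_of_lt hy)) hab'.le
    simp [Real.smoothTransition.zero_of_nonpos hpast]
  · have hfuture : 1 ≤ (y.1 - a) / (b - a) :=
      (one_le_div hab').2 (sub_le_sub_right (le_of_lt hy) a)
    simp [Real.smoothTransition.one_of_one_le hfuture]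

end Calculus

section Integration

variable {V : Type*} [NormedAddCommGroup V] [NormedSpace ℝ V]

theorem integral_eq_of_integral_sub_eq_zero {α : Type*} [MeasurableSpace α] {μ : Measure α}
    {f g : α → V} (hfg : Integrable (f - g) μ) (h : ∫ x, (f - g) x ∂μ = 0) :
    ∫ x, f x ∂μ = ∫ x, g x ∂μ := by
  by_cases hg : Integrable g μ
  · have hf : Integrable f μ := by simpa using hfg.add hg
    rwa [integral_sub' hf hg, sub_eq_zero] at h
  · have hf : ¬Integrable f μ := fun hf => hg (by simpa using hf.sub hfg)
    rw [integral_undef hf, integral_undef hg]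

theorem hasDerivAt_integral_of_compact_support {X : Type*} [TopologicalSpace X] [T2Space X]
    [MeasurableSpace X] [OpensMeasurableSpace X] {μ : Measure X} [IsFiniteMeasureOnCompacts μ]
    {f f' : ℝ → X → V} (hf : ∀ r, Continuous (f r)) (hf' : Continuous (uncurry f'))
    (hderiv : ∀ r x, HasDerivAt (fun s => f s x) (f' r x) r) {K : Set X} (hK : IsCompact K)
    (hfK : ∀ r, ∀ x ∉ K, f r x = 0) (s : ℝ) :
    HasDerivAt (fun r => ∫ x, f r x ∂μ) (∫ x, f' s x ∂μ) s := by
  have hf'K : ∀ r, ∀ x ∉ K, f' r x = 0 := fun r x hx => by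
    refine (hderiv r x).unique ?_
    simpa only [hfK _ x hx] using hasDerivAt_const r (0 : V)
  have hint : ∀ r, Integrable (f r) μ := fun r =>
    (hf r).integrable_of_hasCompactSupport (HasCompactSupport.intro hK (hfK r))
  have hint' : Integrable (f' s) μ := (hf'.comp (Continuous.prodMk_right s)
    ).integrable_of_hasCompactSupport (HasCompactSupport.intro hK (hf'K s))
  obtain ⟨C, hC⟩ := ((isCompact_Icc (a := s - 1) (b := s + 1)).prod hK).exists_bound_of_continuousOn
    hf'.continuousOn
  refine (hasDerivAt_integral_of_dominated_loc_of_deriv_le (bound := K.indicator fun _ => C)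
    (Icc_mem_nhds (sub_one_lt s) (lt_add_one s))
    (Eventually.of_forall fun r => (hint r).aestronglyMeasurable) (hint s)
    hint'.aestronglyMeasurable (Eventually.of_forall fun x r hr => ?_)
    ((integrable_indicator_iff hK.measurableSet).2 (integrableOn_const hK.measure_lt_top.ne))
    (Eventually.of_forall fun x r _ => hderiv r x)).2
  by_cases hx : x ∈ K
  · simpa [hx] using hC (r, x) ⟨hr, hx⟩
  · simp [hx, hf'K r x hx]

variable {E : Type*} [NormedAddCommGroup E] [NormedSpace ℝ E] [MeasurableSpace E]

theorem integrable_fderiv_apply [OpensMeasurableSpace E] {μ : Measure E}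
    [IsFiniteMeasureOnCompacts μ] {f : E → V} (hf : ContDiff ℝ 1 f) (hs : HasCompactSupport f)
    (v : E) : Integrable (fun x => fderiv ℝ f x v) μ :=
  ((hf.continuous_fderiv one_ne_zero).clm_apply continuous_const).integrable_of_hasCompactSupport
    (hs.fderiv_apply ℝ v)

variable [FiniteDimensional ℝ E] [BorelSpace E] {μ : Measure E} [μ.IsAddHaarMeasure]

theorem integral_fderiv_apply_eq_zero {f : E → V} (hf : ContDiff ℝ 1 f)
    (hs : HasCompactSupport f) (v : E) : ∫ x, fderiv ℝ f x v ∂μ = 0 := by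
  -- integration by parts against the constant function `1`
  simpa using integral_smul_fderiv_eq_neg_fderiv_smul_of_integrable (μ := μ) (𝕜 := ℝ)
    (f := fun _ => 1) (g := f) (v := v) (by simp)
    (by simpa using integrable_fderiv_apply hf hs v)
    (by simpa using hf.continuous.integrable_of_hasCompactSupport hs)
    (fun _ _ => differentiableAt_const _) (fun x _ => hf.differentiable one_ne_zero x)

theorem integral_sum_fderiv_apply_eq_zero {ι : Type*} [Fintype ι] {f : ι → E → V}
    (hf : ∀ i, ContDiff ℝ 1 (f i)) (hs : ∀ i, HasCompactSupport (f i)) (v : ι → E) :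
    ∫ x, ∑ i, fderiv ℝ (f i) x (v i) ∂μ = 0 := by
  rw [integral_finsetSum _ fun i _ => integrable_fderiv_apply (hf i) (hs i) (v i)]
  exact Finset.sum_eq_zero fun i _ => integral_fderiv_apply_eq_zero (hf i) (hs i) (v i)

end Integration

section Conservation

variable {n : ℕ} {V : Type*} [NormedAddCommGroup V] [NormedSpace ℝ V]

/-- The space-time divergence `d_μ g^μ` of a vector field with components `g μ`. -/
noncomputable def divergence (g : Fin (n + 1) → Spacetime n → V) (y : Spacetime n) : V :=
  ∑ μ, fderiv ℝ (g μ) y (coordVec n μ)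

theorem divergence_eq_time_add_space {g : Fin (n + 1) → Spacetime n → V}
    (hg : ∀ μ, Differentiable ℝ (g μ)) (s : ℝ) (x : Space n) :
    divergence g (s, x) = fderiv ℝ (g 0) (s, x) (1, 0) +
      ∑ i : Fin n, fderiv ℝ (fun y => g i.succ (s, y)) x (EuclideanSpace.single i 1) := by
  have hslice : ∀ μ, fderiv ℝ (fun y => g μ (s, y)) x =
      (fderiv ℝ (g μ) (s, x)).comp (ContinuousLinearMap.inr ℝ ℝ (Space n)) := fun μ =>
    ((hg μ (s, x)).hasFDerivAt.comp x (hasFDerivAt_prodMk_right s x)).fderiv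
  simp [divergence, Fin.sum_univ_succ, coordVec, hslice]

theorem divergence_sub {g h : Fin (n + 1) → Spacetime n → V} (hg : ∀ μ, Differentiable ℝ (g μ))
    (hh : ∀ μ, Differentiable ℝ (h μ)) (y : Spacetime n) :
    divergence (g - h) y = divergence g y - divergence h y := by
  simp only [divergence, Pi.sub_apply, ← Finset.sum_sub_distrib]
  exact Finset.sum_congr rfl fun μ _ => by rw [fderiv_sub (hg μ y) (hh μ y)]; rfl

theorem integral_eq_of_divergence_eq_zero {g : Fin (n + 1) → Spacetime n → V}
    (hg : ∀ μ, ContDiff ℝ 1 (g μ)) (hdiv : ∀ y, divergence g y = 0) {K : Set (Space n)}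
    (hK : IsCompact K) (hgK : ∀ μ, EqOn (g μ) 0 (Prod.snd ⁻¹' Kᶜ)) (s s' : ℝ) :
    ∫ x, g 0 (s, x) = ∫ x, g 0 (s', x) := by
  have hdiff : ∀ μ, Differentiable ℝ (g μ) := fun μ => (hg μ).differentiable one_ne_zero
  have hsupp : ∀ μ r, ∀ x ∉ K, g μ (r, x) = 0 := fun μ r x hx => hgK μ hx
  have hflux : ∀ r, ∫ x, fderiv ℝ (g 0) (r, x) (1, 0) = 0 := fun r => by
    have hbalance : ∀ x, fderiv ℝ (g 0) (r, x) (1, 0) =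
        -∑ i : Fin n, fderiv ℝ (fun y => g i.succ (r, y)) x (EuclideanSpace.single i 1) :=
      fun x => eq_neg_of_add_eq_zero_left ((divergence_eq_time_add_space hdiff r x).symm.trans
        (hdiv _))
    have hspace := integral_sum_fderiv_apply_eq_zero (μ := volume)
      (f := fun (i : Fin n) y => g i.succ (r, y))
      (fun i => (hg i.succ).comp (contDiff_prodMk_right r))
      (fun i => HasCompactSupport.intro hK (hsupp i.succ r)) (EuclideanSpace.single · 1)
    simp only [hbalance, integral_neg, hspace, neg_zero]
  have hderiv : ∀ r, HasDerivAt (fun r => ∫ x, g 0 (r, x)) 0 r := fun r => by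
    rw [← hflux r]
    exact hasDerivAt_integral_of_compact_support
      (f := fun r x => g 0 (r, x)) (f' := fun r x => fderiv ℝ (g 0) (r, x) (1, 0))
      (fun r => (hg 0).continuous.comp (Continuous.prodMk_right r))
      (((hg 0).continuous_fderiv one_ne_zero).clm_apply continuous_const)
      (fun r x => (hdiff 0 (r, x)).hasFDerivAt.comp_hasDerivAt r
        ((hasDerivAt_id r).prodMk (hasDerivAt_const r x))) hK (hsupp 0) r
  exact is_const_of_deriv_eq_zero (fun r => (hderiv r).differentiableAt)
    (fun r => (hderiv r).deriv) s s'

end Conservation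

section History

variable {n : ℕ} {Λ : Type*} [NormedRing Λ] [NormedAlgebra ℝ Λ]
  {ι : Type*} [Fintype ι] {S : SuperGrading Λ} {par : ι → ZMod 2}
  (T : HamiltonianTheory n S par)

namespace HamiltonianTheory

theorem contDiff_uncurry_evolution {P : Type*} [NormedAddCommGroup P] [NormedSpace ℝ P]
    {τ : P → ℝ} (hτ : ContDiff ℝ ∞ τ) {p : P → Space n → Value S par}
    (hp : ContDiff ℝ ∞ (uncurry p)) :
    ContDiff ℝ ∞ (uncurry fun r => T.evolution (τ r) (p r)) :=
  T.velocity_smooth.comp (((hτ.comp contDiff_fst).prodMk contDiff_snd).prodMk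
    (contDiff_uncurry_jet T.velocityOrder hp))

-- The time step is one more parameter, so the induction runs over all parameter spaces `P`.
theorem contDiff_uncurry_timeDeriv (j : ℕ) {P : Type*} [NormedAddCommGroup P] [NormedSpace ℝ P]
    {τ : P → ℝ} (hτ : ContDiff ℝ ∞ τ) {p : P → Space n → Value S par}
    (hp : ContDiff ℝ ∞ (uncurry p)) :
    ContDiff ℝ ∞ (uncurry fun r => T.timeDeriv j (τ r) (p r)) := by
  induction j generalizing P with
  | zero => exact hp
  | succ j ih =>
    have hev := T.contDiff_uncurry_evolution hτ hp
    have hproj : ContDiff ℝ ∞ fun z : (P × ℝ) × Space n => (z.1.1, z.2) := by fun_prop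
    have htime : ContDiff ℝ ∞ fun r : P × ℝ => τ r.1 + r.2 :=
      (hτ.comp contDiff_fst).add contDiff_snd
    have hstep : ContDiff ℝ ∞
        (uncurry fun r : P × ℝ => p r.1 + r.2 • T.evolution (τ r.1) (p r.1)) :=
      (hp.comp hproj).add ((contDiff_snd.comp contDiff_fst).smul (hev.comp hproj))
    have hswap : ContDiff ℝ ∞ fun z : (P × Space n) × ℝ => ((z.1.1, z.2), z.1.2) := by fun_prop
    exact contDiff_deriv_of_uncurry (f := fun (z : P × Space n) s => T.timeDeriv j (τ z.1 + s)
      (p z.1 + s • T.evolution (τ z.1) (p z.1)) z.2) ((ih htime hstep).comp hswap) 0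

theorem contDiff_history (k : ℕ) (t : ℝ) {p : Space n → Value S par} (hp : ContDiff ℝ ∞ p) :
    ContDiff ℝ ∞ (T.history k t p) :=
  ContDiff.sum fun j _ => (((contDiff_fst.sub contDiff_const).pow j).div_const _).smul
    (T.contDiff_uncurry_timeDeriv j (P := ℝ) (p := fun _ => p) contDiff_const
      (hp.comp contDiff_snd))

variable {U : Set (Space n)} {p q : Space n → Value S par}

theorem eqOn_evolution (hU : IsOpen U) (t : ℝ) (h : EqOn p q U) :
    EqOn (T.evolution t p) (T.evolution t q) U := fun x hx => by
  simp only [evolution, eqOn_jet _ hU h hx]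

theorem eqOn_timeDeriv (hU : IsOpen U) (j : ℕ) (t : ℝ) (h : EqOn p q U) :
    EqOn (T.timeDeriv j t p) (T.timeDeriv j t q) U := by
  induction j generalizing t p q with
  | zero => exact h
  | succ j ih =>
    intro x hx
    have hstep : ∀ s : ℝ, EqOn (p + s • T.evolution t p) (q + s • T.evolution t q) U :=
      fun s y hy => by simp [h hy, T.eqOn_evolution hU t h hy]
    simp only [timeDeriv, ih (t + _) (hstep _) hx]

theorem eqOn_history (k : ℕ) (hU : IsOpen U) (t : ℝ) (h : EqOn p q U) :
    EqOn (T.history k t p) (T.history k t q) (Prod.snd ⁻¹' U) := fun y hy =>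
  Finset.sum_congr rfl fun j _ => by rw [T.eqOn_timeDeriv hU j t h hy]

end HamiltonianTheory

end History

section TopologicalCharge

variable {n k : ℕ} {Λ : Type*} [NormedRing Λ] [NormedAlgebra ℝ Λ]
  {ι : Type*} [Fintype ι] {S : SuperGrading Λ} {par : ι → ZMod 2} {J : Current n k S par}
  {u v : Spacetime n → Value S par}

/-- The current `J` evaluated on the history `u`, as a vector field on space-time. -/
noncomputable def Current.along (J : Current n k S par) (u : Spacetime n → Value S par) :
    Fin (n + 1) → Spacetime n → Λ :=
  fun μ y => J μ y (jet k u y)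

theorem Current.eqOn_along (J : Current n k S par) {U : Set (Spacetime n)} (hU : IsOpen U)
    (h : EqOn u v U) (μ : Fin (n + 1)) : EqOn (J.along u μ) (J.along v μ) U := fun y hy => by
  simp only [along, eqOn_jet k hU h hy]

namespace IsTopologicalCurrent

theorem contDiff_along (hJ : IsTopologicalCurrent J) (hu : ContDiff ℝ ∞ u) (μ : Fin (n + 1)) :
    ContDiff ℝ 1 (J.along u μ) :=
  (hJ.1 μ).comp (contDiff_id.prodMk ((contDiff_jet k hu).of_le (by exact_mod_cast le_top)))

theorem divergence_along_sub (hJ : IsTopologicalCurrent J) (hu : ContDiff ℝ ∞ u)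
    (hv : ContDiff ℝ ∞ v) (y : Spacetime n) : divergence (J.along u - J.along v) y = 0 := by
  rw [divergence_sub (fun μ => (hJ.contDiff_along hu μ).differentiable one_ne_zero)
    (fun μ => (hJ.contDiff_along hv μ).differentiable one_ne_zero)]
  exact sub_eq_zero.2 ((hJ.2 u hu y).trans (hJ.2 v hv y).symm)

theorem integral_along_sub_eq (hJ : IsTopologicalCurrent J) (hu : ContDiff ℝ ∞ u)
    (hv : ContDiff ℝ ∞ v) {K : Set (Space n)} (hK : IsCompact K)
    (huv : EqOn u v (Prod.snd ⁻¹' Kᶜ)) (s s' : ℝ) :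
    ∫ x, (J.along u 0 (s, x) - J.along v 0 (s, x)) =
      ∫ x, (J.along u 0 (s', x) - J.along v 0 (s', x)) :=
  integral_eq_of_divergence_eq_zero (g := J.along u - J.along v)
    (fun μ => (hJ.contDiff_along hu μ).sub (hJ.contDiff_along hv μ))
    (hJ.divergence_along_sub hu hv) hK
    (fun μ _ hy => sub_eq_zero.2
      (J.eqOn_along (hK.isClosed.isOpen_compl.preimage continuous_snd) huv μ hy)) s s'

theorem integral_along_sub_eq_zero (hJ : IsTopologicalCurrent J) (hu : ContDiff ℝ ∞ u)
    (hv : ContDiff ℝ ∞ v) {K : Set (Space n)} (hK : IsCompact K)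
    (huv : EqOn u v (Prod.snd ⁻¹' Kᶜ)) (t : ℝ) :
    ∫ x, (J.along u 0 (t, x) - J.along v 0 (t, x)) = 0 := by
  obtain ⟨w, hw, hpast, hfuture, hwv⟩ :=
    exists_contDiff_eqOn_past_eqOn_future hu hv (show t - 2 < t - 1 by linarith)
  have hnow : ∀ x, J.along w 0 (t, x) = J.along u 0 (t, x) := fun x =>
    J.eqOn_along (isOpen_Ioi.preimage continuous_fst) hfuture 0 (show t - 1 < t by linarith)
  have hbefore : ∀ x, J.along w 0 (t - 3, x) = J.along v 0 (t - 3, x) := fun x =>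
    J.eqOn_along (isOpen_Iio.preimage continuous_fst) hpast 0 (show t - 3 < t - 2 by linarith)
  calc ∫ x, (J.along u 0 (t, x) - J.along v 0 (t, x))
    _ = ∫ x, (J.along w 0 (t, x) - J.along v 0 (t, x)) := by simp only [hnow]
    _ = ∫ x, (J.along w 0 (t - 3, x) - J.along v 0 (t - 3, x)) :=
        hJ.integral_along_sub_eq hw hv hK (fun y hy => hwv y (huv hy)) t (t - 3)
    _ = 0 := by simp only [hbefore, sub_self, integral_zero]

variable (T : HamiltonianTheory n S par) (t : ℝ) {p q : Space n → Value S par}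

theorem continuous_chargeDensity (hJ : IsTopologicalCurrent J) (hp : ContDiff ℝ ∞ p) :
    Continuous (chargeDensity T J t p) :=
  (hJ.contDiff_along (T.contDiff_history k t hp) 0).continuous.comp (Continuous.prodMk_right t)

theorem charge_eq_of_hasCompactSupport_sub (hJ : IsTopologicalCurrent J) (hp : ContDiff ℝ ∞ p)
    (hq : ContDiff ℝ ∞ q) (h : HasCompactSupport (q - p)) : charge T J t q = charge T J t p := by
  have hopen : IsOpen (tsupport (q - p))ᶜ := (isClosed_tsupport _).isOpen_compl
  have hpq : EqOn q p (tsupport (q - p))ᶜ := fun x hx =>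
    sub_eq_zero.1 (image_eq_zero_of_notMem_tsupport (f := q - p) hx)
  have hhistory := T.eqOn_history k hopen t hpq
  have hdensity : ∀ x ∉ tsupport (q - p),
      (chargeDensity T J t q - chargeDensity T J t p) x = 0 := fun x hx =>
    sub_eq_zero.2 (J.eqOn_along (hopen.preimage continuous_snd) hhistory 0
      (show (t, x) ∈ Prod.snd ⁻¹' (tsupport (q - p))ᶜ from hx))
  exact integral_eq_of_integral_sub_eq_zero
    (((hJ.continuous_chargeDensity T t hq).sub
      (hJ.continuous_chargeDensity T t hp)).integrable_of_hasCompactSupport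
        (HasCompactSupport.intro h hdensity))
    (hJ.integral_along_sub_eq_zero (T.contDiff_history k t hq) (T.contDiff_history k t hp) h
      hhistory t)

theorem hasFunctionalDeriv_charge (hJ : IsTopologicalCurrent J) (hp : ContDiff ℝ ∞ p) :
    HasFunctionalDeriv (charge T J t) p 0 := by
  refine ⟨continuous_const, fun η hη => ?_⟩
  have hconst : ∀ ε : ℝ, charge T J t (p + ε • η) = charge T J t p := fun ε =>
    hJ.charge_eq_of_hasCompactSupport_sub T t hp (hp.add (hη.1.const_smul ε)) <| by
      rw [add_sub_cancel_left]
      exact hη.2.smul_left (f := fun _ => ε)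
  simpa [hconst] using hasDerivAt_const (0 : ℝ) (charge T J t p)

theorem hasDerivAt_charge_iff (hJ : IsTopologicalCurrent J) {γ : ℝ → Space n → Value S par}
    (hγ : ∀ s, ContDiff ℝ ∞ (γ s)) (hsupp : ∀ᶠ s in 𝓝 t, HasCompactSupport (γ s - γ t)) (c : Λ) :
    HasDerivAt (fun s => charge T J s (γ s)) c t ↔
      HasDerivAt (fun s => charge T J s (γ t)) c t :=
  EventuallyEq.hasDerivAt_iff <| hsupp.mono fun s hs =>
    hJ.charge_eq_of_hasCompactSupport_sub T s (hγ t) (hγ s) hs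

end IsTopologicalCurrent

end TopologicalCharge

section Brackets

variable {n : ℕ} {Λ : Type*} [NormedRing Λ] [NormedAlgebra ℝ Λ] [CompleteSpace Λ]
  {ι : Type*} [Fintype ι] {S : SuperGrading Λ} {par : ι → ZMod 2}

/- Odd values need not detect elements of `Λ` by multiplication, so functional derivatives are not
unique; only their pairing with values of the field is. -/
theorem HasFunctionalDeriv.pairing_eq_zero {F : (Space n → Value S par) → Λ}
    {p : Space n → Value S par} {D : Space n → ι → Λ × Λ} (hD : HasFunctionalDeriv F p D)
    (h0 : HasFunctionalDeriv F p 0) (w : Value S par) (x : Space n) :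
    ∑ a, (((w a).1 : Λ) * (D x a).1 + ((w a).2 : Λ) * (D x a).2) = 0 := by
  have hcont : Continuous fun x =>
      ∑ a, (((w a).1 : Λ) * (D x a).1 + ((w a).2 : Λ) * (D x a).2) := by
    have := hD.1
    fun_prop
  have hae := ae_eq_zero_of_integral_contDiff_smul_eq_zero (μ := volume)
    hcont.locallyIntegrable fun g hg hgs => by
      have hη : IsTest fun x : Space n => g x • w := ⟨hg.smul contDiff_const, hgs.smul_right⟩
      simpa [Finset.smul_sum, smul_add] using (hD.2 _ hη).unique (h0.2 _ hη)
  exact congrFun ((hcont.ae_eq_iff_eq volume continuous_const).1 hae) x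

theorem HasFunctionalDeriv.hasBracket_iff {F G : (Space n → Value S par) → Λ}
    {p X : Space n → Value S par} (h0 : HasFunctionalDeriv F p 0)
    (hX : IsHamiltonianField G p X) (c : Λ) : HasBracket F G p c ↔ c = 0 := by
  constructor
  · rintro ⟨D, Y, hD, -, -, rfl⟩
    simp [hD.pairing_eq_zero h0]
  · rintro rfl
    exact ⟨0, X, h0, hX, by simp, by simp⟩

open Classical in
theorem isHamiltonianField_fieldObs (a : ι) {f : Space n → S.part (par a)} (hf : IsTest f)
    {p : Space n → Value S par} (hp : ContDiff ℝ ∞ p) :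
    IsHamiltonianField (fieldObs a f) p (fun x => Function.update 0 a (0, -f x)) := by
  refine ⟨continuous_const.update a (continuous_const.prodMk hf.1.continuous.neg), fun η hη => ?_⟩
  convert (field_hasFunctionalDeriv a f hf p hp).2 η hη using 4 with x b
  rcases eq_or_ne b a with rfl | hb
  · simp
  · simp [hb]

end Brackets

end FieldTheory

theorem theorem1_general {n k : ℕ} {Λ : Type*} [NormedRing Λ] [NormedAlgebra ℝ Λ]
    [CompleteSpace Λ] {ι : Type*} [Fintype ι] (S : SuperGrading Λ) (par : ι → ZMod 2)
    (T : HamiltonianTheory n S par) (J : Current n k S par) (hJ : IsTopologicalCurrent J) :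
    (∀ (t : ℝ) (p : Space n → Value S par), ContDiff ℝ ∞ p →
      Integrable (chargeDensity T J t p) →
      HasFunctionalDeriv (charge T J t) p 0 ∧
      (∀ (a : ι) (f : Space n → S.part (par a)), IsTest f → ∀ c : Λ,
        HasBracket (charge T J t) (fieldObs a f) p c ↔ c = 0) ∧
      (∀ (a : ι) (f : Space n → S.part (par a)), IsTest f → ∀ c : Λ,
        HasBracket (charge T J t) (momentumObs a f) p c ↔ c = 0) ∧
      (∀ (G : (Space n → Value S par) → Λ) (X : Space n → Value S par),
        IsHamiltonianField G p X → ∀ c : Λ, HasBracket (charge T J t) G p c ↔ c = 0) ∧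
      (∀ c : Λ, HasBracket (charge T J t) (T.hamiltonian t p) p c ↔ c = 0) ∧
      (∀ q c : Λ, HasDerivAt (fun s => charge T J s p) q t →
        HasBracket (charge T J t) (T.hamiltonian t p) p c → q + c = 0 → q = 0)) ∧
    (∀ (t : ℝ) (γ : ℝ → Space n → Value S par), (∀ s, ContDiff ℝ ∞ (γ s)) →
      (∀ᶠ s in 𝓝 t, HasCompactSupport (γ s - γ t)) → ∀ q : Λ,
      (HasDerivAt (fun s => charge T J s (γ s)) q t ↔
        HasDerivAt (fun s => charge T J s (γ t)) q t)) := by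
  refine ⟨fun t p hp _ => ?_, fun t γ hγ hsupp => hJ.hasDerivAt_charge_iff T t hγ hsupp⟩
  have hQ := hJ.hasFunctionalDeriv_charge T t hp
  have hQH := hQ.hasBracket_iff (T.hamilton t p hp)
  exact ⟨hQ, fun a f hf => hQ.hasBracket_iff (isHamiltonianField_fieldObs a hf hp),
    fun a f hf => hQ.hasBracket_iff (momentum_ham a f hf p hp),
    fun G X hX => hQ.hasBracket_iff hX, hQH,
    fun q c _ hc hqc => by simpa [(hQH c).1 hc] using hqc⟩

theorem theorem1 {n k : ℕ} {Λ : Type*} [NormedRing Λ] [NormedAlgebra ℝ Λ] [CompleteSpace Λ]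
    {ι : Type*} [Fintype ι] (S : SuperGrading Λ) (par : ι → ZMod 2)
    (T : HamiltonianTheory n S par) (J : Current n k S par) (hJ : IsTopologicalCurrent J) :
    (∀ (t : ℝ) (p : Space n → Value S par), ContDiff ℝ ∞ p →
      Integrable (chargeDensity T J t p) →
      -- all functional derivatives `δQ/δφ^a(x)`, `δQ/δπ_a(x)` of the charge vanish
      HasFunctionalDeriv (charge T J t) p 0 ∧
      -- the charge generates no transformation of `φ` and `π`
      (∀ (a : ι) (f : Space n → S.part (par a)), IsTest f → ∀ c : Λ,
        HasBracket (charge T J t) (fieldObs a f) p c ↔ c = 0) ∧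
      (∀ (a : ι) (f : Space n → S.part (par a)), IsTest f → ∀ c : Λ,
        HasBracket (charge T J t) (momentumObs a f) p c ↔ c = 0) ∧
      -- its bracket with every Hamiltonian vanishes, in particular with that of the theory
      (∀ (G : (Space n → Value S par) → Λ) (X : Space n → Value S par),
        IsHamiltonianField G p X → ∀ c : Λ, HasBracket (charge T J t) G p c ↔ c = 0) ∧
      (∀ c : Λ, HasBracket (charge T J t) (T.hamiltonian t p) p c ↔ c = 0) ∧
      -- if it is conserved, `∂Q/∂t + {Q, H} = 0`, then `∂Q/∂t = 0`
      (∀ q c : Λ, HasDerivAt (fun s => charge T J s p) q t →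
        HasBracket (charge T J t) (T.hamiltonian t p) p c → q + c = 0 → q = 0)) ∧
    -- if it is conserved along a motion that is constant in time near spatial infinity, then
    -- it has no explicit time dependence there
    (∀ (t : ℝ) (u : Spacetime n → Value S par), ContDiff ℝ ∞ u → T.IsMotionNear t u →
      (∀ᶠ s in 𝓝 t, HasCompactSupport (fun x => u (s, x) - u (t, x))) →
      HasDerivAt (fun s => charge T J s (fun x => u (s, x))) 0 t →
      HasDerivAt (fun s => charge T J s (fun x => u (t, x))) 0 t) :=
  ⟨(theorem1_general S par T J hJ).1, fun t u hu _ hsupp => ((theorem1_general S par T J hJ).2 t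
    (fun s x => u (s, x)) (fun s => hu.comp (contDiff_prodMk_right s)) hsupp 0).1⟩
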